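/- Let $\mathbb{K}$ be a field of characteristic zero and $S=\mathbb{K}[x_1,\dots,x_l]$. Let $\mathcal{A}=\{H_1,\dots,H_n\}$ be a central hyperplane arrangement in $\mathbb{K}^l$, i.e. a finite set of distinct linear hyperplanes, and for each $i$ fix a homogeneous linear form $\alpha_i\in S$ with $H_i=\alpha_i^{-1}(0)$. Put $Q(\mathcal{A})=\prod_{i=1}^n\alpha_i$ and let $J(\mathcal{A})\subseteq S$ be the Jacobian ideal, generated by $Q(\mathcal{A})$ and all its partial derivatives $\partial_{x_1}Q(\mathcal{A}),\dots,\partial_{x_l}Q(\mathcal{A})$. Let $L(\mathcal{A})$ be the set of flats, i.e. of all intersections $\bigcap_{H\in\mathcal{B}}H$ with $\mathcal{B}\subseteq\mathcal{A}$, let $L(\mathcal{A})_2$ be the set of flats of codimension $2$, and for a flat $X$ let $I(X)\subseteq S$ be the ideal generated by the forms $\alpha_i$ with $X\subseteq H_i$ (equivalently, by the forms of any hyperplanes of $\mathcal{A}$ whose intersection is $X$). Suppose that $\mathcal{A}$ is free, i.e. that the $S$-module $$D(\mathcal{A})=\Big\{\delta=\sum_{j=1}^l f_j\partial_{x_j}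 : f_j\in S,\ \delta(\alpha_i)\in\alpha_iS \text{ for all } i\Big\}$$ is free with a basis $\delta_1,\dots,\delta_l$ of homogeneous vector fields (for each $i$, the coefficients $\delta_i(x_1),\dots,\delta_i(x_l)$ are homogeneous polynomials of one common degree $e_i$). Then $$\operatorname{Ass}_S\big(S/J(\mathcal{A})\big)=\{I(X) : X\in L(\mathcal{A})_2\}.$$ In particular $S/J(\mathcal{A})$ has no embedded primes: every associated prime of $S/J(\mathcal{A})$ is minimal among the prime ideals containing $J(\mathcal{A})$. -/

import Mathlib

/-- A central hyperplane arrangement in `K ^ l`: a finite set of linear hyperplanes, together with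
a fixed choice, for each hyperplane `H`, of a homogeneous linear polynomial in
`S = K[x_1, …, x_l]` whose zero set is `H`. -/
structure CentralArrangement (K : Type*) [Field K] (l : ℕ) where
  /-- The hyperplanes of the arrangement. -/
  hyperplanes : Finset (Submodule K (Fin l → K))
  codim_eq_one : ∀ H ∈ hyperplanes, Module.finrank K ((Fin l → K) ⧸ H) = 1
  /-- The chosen defining polynomial of each hyperplane. -/
  form : {H // H ∈ hyperplanes} → MvPolynomial (Fin l) K
  form_isHomogeneous : ∀ H, (form H).IsHomogeneous 1
  form_zero_locus : ∀ H (v : Fin l → K), MvPolynomial.eval v (form H) = 0 ↔ v ∈ H.1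

namespace CentralArrangement

variable {K : Type*} [Field K] {l : ℕ} (A : CentralArrangement K l)

/-- The defining polynomial `Q(A)`, the product of the chosen linear forms. -/
noncomputable def definingPolynomial : MvPolynomial (Fin l) K := ∏ H, A.form H

/-- The Jacobian ideal `J(A)`: the ideal generated by `Q(A)` and all its partial derivatives. -/
noncomputable def jacobianIdeal : Ideal (MvPolynomial (Fin l) K) :=
  Ideal.span ({A.definingPolynomial} ∪
    Set.range fun i : Fin l => MvPolynomial.pderiv i A.definingPolynomial)

/-- The set of flats (the intersection lattice) `L(A)`: all intersections of subsets of `A`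
(the empty intersection being the whole space). -/
def flats : Set (Submodule K (Fin l → K)) :=
  {X | ∃ B ⊆ A.hyperplanes, X = B.inf id}

/-- `L(A)_p`: the flats of rank (that is, codimension) `p`. -/
def flatsOfRank (p : ℕ) : Set (Submodule K (Fin l → K)) :=
  {X ∈ A.flats | Module.finrank K ((Fin l → K) ⧸ X) = p}

/-- `I(X)`: the ideal generated by the linear forms of the hyperplanes that contain `X`. It is
already generated by the forms of any family of hyperplanes of `A` with intersection `X`, see
`flatIdeal_inf`. -/
noncomputable def flatIdeal (X : Submodule K (Fin l → K)) : Ideal (MvPolynomial (Fin l) K) :=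
  Ideal.span {f | ∃ H : {H // H ∈ A.hyperplanes}, X ≤ H.1 ∧ f = A.form H}

/-- `I(X)` is generated by the forms of any hyperplanes of `A` whose intersection is `X`. -/
theorem flatIdeal_inf (B : Finset (Submodule K (Fin l → K))) (hB : B ⊆ A.hyperplanes) :
    A.flatIdeal (B.inf id) =
      Ideal.span {f | ∃ H : {H // H ∈ A.hyperplanes}, H.1 ∈ B ∧ f = A.form H} := by
  classical
  apply le_antisymm
  · refine Ideal.span_le.2 ?_
    rintro _ ⟨H, hX, rfl⟩
    have hlin : ∀ H, ∃ c : Fin l → K,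
        ∑ i, c i • (MvPolynomial.X i : MvPolynomial (Fin l) K) = A.form H := fun H => by
      have h := (MvPolynomial.mem_homogeneousSubmodule 1 _).2 (A.form_isHomogeneous H)
      rwa [MvPolynomial.homogeneousSubmodule_one_eq_span_X,
        Submodule.mem_span_range_iff_exists_fun] at h
    choose c hc using hlin
    let φ : {H // H ∈ A.hyperplanes} → ((Fin l → K) →ₗ[K] K) := fun H =>
      ∑ i, c H i • LinearMap.proj i
    have hφ : ∀ H v, φ H v = MvPolynomial.eval v (A.form H) := fun H v => by
      rw [← hc H]; simp [φ, MvPolynomial.smul_eval]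
    let ι := {H : {H // H ∈ A.hyperplanes} // H.1 ∈ B}
    have hker : ⨅ i : ι, LinearMap.ker (φ i.1) ≤ LinearMap.ker (φ H) := fun v hv => by
      rw [LinearMap.mem_ker, hφ, A.form_zero_locus]
      apply hX
      rw [Submodule.mem_finsetInf]
      intro G hG
      have := (Submodule.mem_iInf _).1 hv ⟨⟨G, hB hG⟩, hG⟩
      rwa [LinearMap.mem_ker, hφ, A.form_zero_locus] at this
    obtain ⟨a, ha⟩ := (Submodule.mem_span_range_iff_exists_fun K).1
      (mem_span_of_iInf_ker_le_ker hker)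
    have key : A.form H = ∑ i : ι, MvPolynomial.C (a i) * A.form i.1 := by
      have hcoef : ∀ j, c H j = ∑ i : ι, a i * c i.1 j := fun j => by
        have := congrArg (fun f => f (Pi.single j 1)) ha
        simpa [φ, Pi.single_apply] using this.symm
      simp_rw [← hc, ← MvPolynomial.smul_eq_C_mul, Finset.smul_sum, smul_smul]
      rw [Finset.sum_comm]
      simp_rw [← Finset.sum_smul, ← hcoef]
    show A.form H ∈ _
    rw [key]
    exact Ideal.sum_mem _ fun i _ => Ideal.mul_mem_left _ _ (Ideal.subset_span ⟨i.1, i.2, rfl⟩)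
  · refine Ideal.span_mono ?_
    rintro f ⟨H, hH, rfl⟩
    exact ⟨H, Finset.inf_le (f := id) hH, rfl⟩

/-- `D(A)`: the `S`-module of the polynomial vector fields `δ` (derivations of `S` over `K`) that
are logarithmic along `A`: `δ(α_H)` lies in the ideal `(α_H)` for every `H` in `A`. -/
noncomputable def logDerivations :
    Submodule (MvPolynomial (Fin l) K)
      (Derivation K (MvPolynomial (Fin l) K) (MvPolynomial (Fin l) K)) where
  carrier := {δ | ∀ H, δ (A.form H) ∈ Ideal.span {A.form H}}
  zero_mem' := fun H => by simp
  add_mem' := fun ha hb H => by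
    simpa using Ideal.add_mem _ (ha H) (hb H)
  smul_mem' := fun c δ h H => by
    simpa using Ideal.mul_mem_left _ c (h H)

/-- `A` is free with exponents `e`: the `S`-module `D(A)` has a basis `δ_1, …, δ_l` with `δ_i`
homogeneous of polynomial degree `e_i`, that is, all coefficients `δ_i(x_j)` are homogeneous of
degree `e_i`. -/
def IsFreeWithExponents (e : Fin l → ℕ) : Prop :=
  ∃ b : Module.Basis (Fin l) (MvPolynomial (Fin l) K) A.logDerivations,
    ∀ i j : Fin l, ((b i).1 (MvPolynomial.X j)).IsHomogeneous (e i)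

/-- `A` is free if it is free with some exponents. -/
def IsFree : Prop := ∃ e : Fin l → ℕ, A.IsFreeWithExponents e

end CentralArrangement

/-! Write `J` for the Jacobian ideal. A prime containing `J` contains two distinct forms
(`exists_forms_mem_of_jacobianIdeal_le`), so the `I(X)` with `X` of codimension 2 are minimal over
`J`, hence associated. For the converse, `(δ, h) ↦ δ Q + h Q` maps `Der ⊕ S` onto `J` with kernel
isomorphic to `D(A)`. If `D(A)` is free, `S/J` thus has a free resolution of length 2, and a regular
sequence of length 3 cannot kill a nonzero class in `S/J`. `mem_jacobianIdeal_of_regular` carries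
this out as an explicit Koszul chase. An associated prime strictly larger than the ideal of its two
forms would contain such a sequence. -/

/-! ### Linear ideals and derivations of polynomial rings -/

open MvPolynomial in
/-- An ideal generated by linear forms admitting a dual family of vectors is prime. -/
theorem MvPolynomial.isPrime_span_range_of_dual {K σ ι : Type*} [Field K] [Fintype σ] [Fintype ι]
    [DecidableEq ι] (a : ι → MvPolynomial σ K) (ha : ∀ i, (a i).IsHomogeneous 1) (e : ι → σ → K)
    (he : ∀ i j, eval (e i) (a j) = if i = j then 1 else 0) :
    (Ideal.span (Set.range a)).IsPrime := by
  classical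
  have hlin : ∀ i, ∃ c : σ → K, ∑ s, c s • (X s : MvPolynomial σ K) = a i := fun i => by
    have h := (mem_homogeneousSubmodule 1 _).2 (ha i)
    rwa [homogeneousSubmodule_one_eq_span_X, Submodule.mem_span_range_iff_exists_fun] at h
  choose c hc using hlin
  -- Pullback along the projection `v ↦ v - ∑ a_i(v) e_i` onto the common zero space. The ideal is
  -- its kernel, and the target is a domain.
  let ψ : MvPolynomial σ K →ₐ[K] MvPolynomial σ K := aeval fun s => X s - ∑ i, C (e i s) * a i
  have hψa : ∀ j, ψ (a j) = 0 := fun j => by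
    have hev : ∀ i, ∑ s, c j s * e i s = if i = j then 1 else 0 := fun i => by
      rw [← he i j, ← hc j]
      simp [smul_eval]
    have hsum : ∑ s, C (c j s) * ∑ i, C (e i s) * a i = a j := by
      simp_rw [Finset.mul_sum]
      rw [Finset.sum_comm]
      simp_rw [← mul_assoc, ← C_mul, ← Finset.sum_mul, ← map_sum, hev]
      simp
    calc ψ (a j) = ψ (∑ s, c j s • X s) := by rw [hc j]
      _ = ∑ s, c j s • X s - ∑ s, C (c j s) * ∑ i, C (e i s) * a i := by
        simp [ψ, smul_eq_C_mul, mul_sub, Finset.sum_sub_distrib]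
      _ = 0 := by rw [hsum, hc j, sub_self]
  have hmod : ∀ f, f - ψ f ∈ Ideal.span (Set.range a) := fun f => by
    rw [← Ideal.Quotient.eq]
    have : (Ideal.Quotient.mkₐ K (Ideal.span (Set.range a))) =
        (Ideal.Quotient.mkₐ K (Ideal.span (Set.range a))).comp ψ := by
      apply algHom_ext
      intro s
      simp only [Ideal.Quotient.mkₐ_eq_mk, AlgHom.comp_apply, ψ, aeval_X]
      rw [Ideal.Quotient.eq, sub_sub_cancel]
      exact Ideal.sum_mem _ fun i _ => Ideal.mul_mem_left _ _ (Ideal.subset_span ⟨i, rfl⟩)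
    exact DFunLike.congr_fun this f
  have hker : Ideal.span (Set.range a) = RingHom.ker ψ := by
    apply le_antisymm
    · rw [Ideal.span_le]
      rintro _ ⟨j, rfl⟩
      exact hψa j
    · intro f hf
      simpa [(RingHom.mem_ker).1 hf] using hmod f
  rw [hker]
  exact RingHom.ker_isPrime _

theorem Derivation.dvd_apply_prod {R S ι : Type*} [CommRing R] [CommRing S] [Algebra R S]
    (δ : Derivation R S S) (s : Finset ι) (f : ι → S) (h : ∀ i ∈ s, f i ∣ δ (f i)) :
    ∏ i ∈ s, f i ∣ δ (∏ i ∈ s, f i) := by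
  classical
  induction s using Finset.induction_on with
  | empty => simp
  | insert a s ha ih =>
    rw [Finset.prod_insert ha, Derivation.leibniz, smul_eq_mul, smul_eq_mul]
    refine dvd_add (mul_dvd_mul_left _ (ih fun i hi => h i (Finset.mem_insert_of_mem hi))) ?_
    rw [mul_comm]
    exact mul_dvd_mul_left _ (h a (Finset.mem_insert_self a s))

/-- Exactness of the Koszul complex of the regular sequence `a, b`, applied to each coefficient: a
derivation is determined freely by its values on the variables. -/
theorem MvPolynomial.dvd_derivation_of_mul_eq_mul {K σ : Type*} [Field K]
    {a b : MvPolynomial σ K} (ha : a ≠ 0) (hab : ∀ x, a ∣ b * x → a ∣ x)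
    (δ η : Derivation K (MvPolynomial σ K) (MvPolynomial σ K)) (h : b • δ = a • η) :
    ∃ v : Derivation K (MvPolynomial σ K) (MvPolynomial σ K), δ = a • v ∧ η = b • v := by
  have h1 : ∀ s, b * δ (X s) = a * η (X s) := fun s => by
    simpa using congrArg (fun d => d (X s)) h
  choose v hv using fun s => hab _ ⟨_, h1 s⟩
  refine ⟨mkDerivation K v, derivation_ext fun s => ?_, derivation_ext fun s => ?_⟩
  · simp [mkDerivation_X, hv]
  · apply mul_left_cancel₀ ha
    rw [← h1, hv]
    simp [mkDerivation_X, mul_left_comm]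

theorem Derivation.sum_smul_apply {R S ι : Type*} [CommRing R] [CommRing S] [Algebra R S]
    (s : Finset ι) (c : ι → S) (δ : ι → Derivation R S S) (x : S) :
    (∑ i ∈ s, c i • δ i) x = ∑ i ∈ s, c i * δ i x := by
  classical
  induction s using Finset.induction_on with
  | empty => simp
  | insert a s ha ih => simp [Finset.sum_insert ha, ih]

namespace CentralArrangement

variable {K : Type*} [Field K] {l : ℕ} (A : CentralArrangement K l)

open MvPolynomial

/-! ### Forms and hyperplanes -/

theorem exists_form_eq_sum (H : {H // H ∈ A.hyperplanes}) :
    ∃ c : Fin l → K, ∑ i, c i • (X i : MvPolynomial (Fin l) K) = A.form H := by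
  have h := (mem_homogeneousSubmodule 1 _).2 (A.form_isHomogeneous H)
  rwa [homogeneousSubmodule_one_eq_span_X, Submodule.mem_span_range_iff_exists_fun] at h

theorem exists_linearMap_eq_eval (H : {H // H ∈ A.hyperplanes}) :
    ∃ φ : (Fin l → K) →ₗ[K] K, ∀ v, φ v = eval v (A.form H) := by
  obtain ⟨c, hc⟩ := A.exists_form_eq_sum H
  refine ⟨∑ i, c i • LinearMap.proj i, fun v => ?_⟩
  rw [← hc]
  simp [smul_eval]

theorem exists_eval_eq_one {H : {H // H ∈ A.hyperplanes}} {v : Fin l → K} (hv : v ∉ H.1) :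
    ∃ t : K, eval (t • v) (A.form H) = 1 := by
  obtain ⟨φ, hφ⟩ := A.exists_linearMap_eq_eval H
  have h : φ v ≠ 0 := by rwa [hφ, Ne, A.form_zero_locus]
  exact ⟨(φ v)⁻¹, by rw [← hφ, map_smul, smul_eq_mul, inv_mul_cancel₀ h]⟩

theorem hyperplane_ne_top (H : {H // H ∈ A.hyperplanes}) : H.1 ≠ ⊤ := fun h => by
  have h1 := A.codim_eq_one H.1 H.2
  have h2 := Submodule.finrank_quotient_add_finrank H.1
  rw [h1, h, finrank_top] at h2
  omega

theorem eq_of_le_of_finrank_quotient_eq {V : Type*} [AddCommGroup V] [Module K V]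
    [FiniteDimensional K V] {X Y : Submodule K V} (h : X ≤ Y)
    (hr : Module.finrank K (V ⧸ X) = Module.finrank K (V ⧸ Y)) : X = Y := by
  refine Submodule.eq_of_le_of_finrank_eq h ?_
  have h1 := Submodule.finrank_quotient_add_finrank X
  have h2 := Submodule.finrank_quotient_add_finrank Y
  omega

theorem hyperplane_eq_of_le {H G : {H // H ∈ A.hyperplanes}} (h : H.1 ≤ G.1) : H = G :=
  Subtype.ext (eq_of_le_of_finrank_quotient_eq h
    ((A.codim_eq_one H.1 H.2).trans (A.codim_eq_one G.1 G.2).symm))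

theorem form_prime (H : {H // H ∈ A.hyperplanes}) : Prime (A.form H) := by
  obtain ⟨v, -, hv⟩ := SetLike.exists_of_lt (lt_top_iff_ne_top.2 (A.hyperplane_ne_top H))
  obtain ⟨t, ht⟩ := A.exists_eval_eq_one hv
  have h := isPrime_span_range_of_dual (fun _ : Unit => A.form H)
    (fun _ => A.form_isHomogeneous H) (fun _ => t • v) (by simp [ht])
  rw [Set.range_const] at h
  refine (Ideal.span_singleton_prime fun h0 => ?_).1 h
  simp [h0] at ht

theorem not_form_dvd_form {H G : {H // H ∈ A.hyperplanes}} (h : H ≠ G) :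
    ¬ A.form H ∣ A.form G := by
  rintro ⟨r, hr⟩
  refine h (A.hyperplane_eq_of_le fun v hv => ?_)
  rw [← A.form_zero_locus] at hv ⊢
  rw [hr, map_mul, hv, zero_mul]

/-- Two distinct hyperplanes admit a pair of vectors dual to their forms. -/
theorem exists_dual_vectors {H G : {H // H ∈ A.hyperplanes}} (h : H ≠ G) :
    ∃ u v : Fin l → K, eval u (A.form H) = 1 ∧ eval u (A.form G) = 0 ∧
      eval v (A.form H) = 0 ∧ eval v (A.form G) = 1 := by
  obtain ⟨v, hvH, hvG⟩ := SetLike.not_le_iff_exists.1 fun hle => h (A.hyperplane_eq_of_le hle)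
  obtain ⟨u, huG, huH⟩ :=
    SetLike.not_le_iff_exists.1 fun hle => h (A.hyperplane_eq_of_le hle).symm
  obtain ⟨s, hs⟩ := A.exists_eval_eq_one huH
  obtain ⟨t, ht⟩ := A.exists_eval_eq_one hvG
  exact ⟨s • u, t • v, hs, (A.form_zero_locus _ _).2 (Submodule.smul_mem _ _ huG),
    (A.form_zero_locus _ _).2 (Submodule.smul_mem _ _ hvH), ht⟩

theorem span_pair_form_isPrime {H G : {H // H ∈ A.hyperplanes}} (h : H ≠ G) :
    (Ideal.span {A.form H, A.form G}).IsPrime := by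
  obtain ⟨u, v, h1, h2, h3, h4⟩ := A.exists_dual_vectors h
  have hp := isPrime_span_range_of_dual ![A.form H, A.form G]
    (by simp [Fin.forall_fin_two, A.form_isHomogeneous]) ![u, v]
    (by simp [Fin.forall_fin_two, h1, h2, h3, h4])
  rwa [Matrix.range_cons_cons_empty] at hp

/-! ### Flats of codimension 2 -/

theorem finrank_quotient_inf {H G : {H // H ∈ A.hyperplanes}} (h : H ≠ G) :
    Module.finrank K ((Fin l → K) ⧸ (H.1 ⊓ G.1)) = 2 := by
  obtain ⟨u, v, h1, h2, h3, h4⟩ := A.exists_dual_vectors h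
  obtain ⟨φ, hφ⟩ := A.exists_linearMap_eq_eval H
  obtain ⟨χ, hχ⟩ := A.exists_linearMap_eq_eval G
  have hker : LinearMap.ker (φ.prod χ) = H.1 ⊓ G.1 := by
    ext w
    simp [hφ, hχ, A.form_zero_locus]
  have hsurj : Function.Surjective (φ.prod χ) := fun ⟨x, y⟩ => by
    refine ⟨x • u + y • v, ?_⟩
    simp only [← hφ, ← hχ] at h1 h2 h3 h4
    simp [h1, h2, h3, h4]
  rw [← hker, ((φ.prod χ).quotKerEquivOfSurjective hsurj).finrank_eq]
  simp

theorem inf_mem_flatsOfRank_two {H G : {H // H ∈ A.hyperplanes}} (h : H ≠ G) :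
    H.1 ⊓ G.1 ∈ A.flatsOfRank 2 := by
  classical
  refine ⟨⟨{H.1, G.1}, ?_, by simp⟩, A.finrank_quotient_inf h⟩
  simp [Finset.insert_subset_iff, H.2, G.2]

theorem flatIdeal_inf_pair (H G : {H // H ∈ A.hyperplanes}) :
    A.flatIdeal (H.1 ⊓ G.1) = Ideal.span {A.form H, A.form G} := by
  classical
  have h := A.flatIdeal_inf {H.1, G.1} (by simp [Finset.insert_subset_iff, H.2, G.2])
  rw [Finset.inf_insert, Finset.inf_singleton, id, id] at h
  rw [h]
  congr 1
  ext f
  simp only [Finset.mem_insert, Finset.mem_singleton, Set.mem_ofPred_eq, Set.mem_insert_iff,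
    Set.mem_singleton_iff]
  constructor
  · rintro ⟨F, hF | hF, rfl⟩
    · exact .inl (congrArg _ (Subtype.ext hF))
    · exact .inr (congrArg _ (Subtype.ext hF))
  · rintro (rfl | rfl)
    · exact ⟨H, .inl rfl, rfl⟩
    · exact ⟨G, .inr rfl, rfl⟩

theorem exists_eq_inf_of_mem_flatsOfRank_two {X : Submodule K (Fin l → K)}
    (hX : X ∈ A.flatsOfRank 2) :
    ∃ H G : {H // H ∈ A.hyperplanes}, H ≠ G ∧ X = H.1 ⊓ G.1 := by
  obtain ⟨⟨B, hB, hXB⟩, hr⟩ := hX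
  have hne : B.Nonempty := by
    rw [Finset.nonempty_iff_ne_empty]
    rintro rfl
    rw [hXB, Finset.inf_empty] at hr
    have := Submodule.finrank_quotient_add_finrank (⊤ : Submodule K (Fin l → K))
    rw [hr, finrank_top] at this
    omega
  obtain ⟨H, hH⟩ := hne
  have hex : ∃ G ∈ B, H ≠ G := by
    by_contra! hall
    have hXH : X = H := by
      rw [hXB]
      exact le_antisymm (Finset.inf_le (f := id) hH)
        (Finset.le_inf fun G hG => (hall G hG).le)
    rw [hXH, A.codim_eq_one H (hB hH)] at hr
    omega
  obtain ⟨G, hG, hHG⟩ := hex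
  have hHG' : (⟨H, hB hH⟩ : {H // H ∈ A.hyperplanes}) ≠ ⟨G, hB hG⟩ :=
    fun h => hHG (congrArg Subtype.val h)
  refine ⟨⟨H, hB hH⟩, ⟨G, hB hG⟩, hHG', eq_of_le_of_finrank_quotient_eq ?_ ?_⟩
  · rw [hXB]
    exact le_inf (Finset.inf_le (f := id) hH) (Finset.inf_le (f := id) hG)
  · rw [hr, A.finrank_quotient_inf hHG']

theorem eval_eq_zero_of_mem_flatIdeal {X : Submodule K (Fin l → K)} {f : MvPolynomial (Fin l) K}
    (hf : f ∈ A.flatIdeal X) {v : Fin l → K} (hv : v ∈ X) : eval v f = 0 := by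
  have h : A.flatIdeal X ≤ RingHom.ker (eval v) := Ideal.span_le.2 <| by
    rintro _ ⟨H, hH, rfl⟩
    exact (A.form_zero_locus H v).2 (hH hv)
  exact h hf

/-! ### The Jacobian ideal, logarithmic derivations and minimal primes -/

theorem definingPolynomial_eq_mul [DecidableEq {H // H ∈ A.hyperplanes}]
    (H : {H // H ∈ A.hyperplanes}) :
    A.definingPolynomial = A.form H * ∏ G ∈ Finset.univ.erase H, A.form G :=
  (Finset.mul_prod_erase _ _ (Finset.mem_univ H)).symm

theorem mem_jacobianIdeal_iff {f : MvPolynomial (Fin l) K} :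
    f ∈ A.jacobianIdeal ↔
      ∃ (δ : Derivation K (MvPolynomial (Fin l) K) (MvPolynomial (Fin l) K))
        (h : MvPolynomial (Fin l) K),
        f = δ A.definingPolynomial + h * A.definingPolynomial := by
  rw [jacobianIdeal, Ideal.span_union, Submodule.mem_sup]
  constructor
  · rintro ⟨y, hy, z, hz, rfl⟩
    obtain ⟨h, rfl⟩ := Ideal.mem_span_singleton'.1 hy
    obtain ⟨c, rfl⟩ := (Submodule.mem_span_range_iff_exists_fun _).1 hz
    refine ⟨∑ i, c i • pderiv i, h, ?_⟩
    rw [Derivation.sum_smul_apply, add_comm]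
    rfl
  · rintro ⟨δ, h, rfl⟩
    have hδ : δ = ∑ i, δ (X i) • pderiv i := derivation_ext fun j => by
      rw [Derivation.sum_smul_apply]
      simp [pderiv_X, Pi.single_apply]
    refine ⟨_, Ideal.mem_span_singleton'.2 ⟨h, rfl⟩, δ A.definingPolynomial, ?_, add_comm _ _⟩
    rw [hδ, Derivation.sum_smul_apply]
    exact Submodule.sum_mem _ fun i _ => Ideal.mul_mem_left _ _ (Ideal.subset_span ⟨i, rfl⟩)

/-- Logarithmic derivations are those that preserve the ideal of the defining polynomial. -/
theorem mem_logDerivations_iff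
    {δ : Derivation K (MvPolynomial (Fin l) K) (MvPolynomial (Fin l) K)} :
    δ ∈ A.logDerivations ↔ A.definingPolynomial ∣ δ A.definingPolynomial := by
  classical
  constructor
  · intro h
    exact δ.dvd_apply_prod _ _ fun H _ => Ideal.mem_span_singleton.1 (h H)
  · intro h H
    rw [Ideal.mem_span_singleton]
    have hd : A.form H ∣ δ A.definingPolynomial :=
      (Dvd.intro _ (A.definingPolynomial_eq_mul H).symm).trans h
    rw [A.definingPolynomial_eq_mul H, Derivation.leibniz, smul_eq_mul, smul_eq_mul,
      dvd_add_right (dvd_mul_right _ _)] at hd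
    -- The Leibniz rule leaves `α_H ∣ R * δ α_H`, where `R` is the product of the other forms, none
    -- divisible by the prime `α_H`.
    refine ((A.form_prime H).dvd_or_dvd hd).resolve_left fun hp => ?_
    obtain ⟨G, hG, hGd⟩ := ((A.form_prime H).dvd_finsetProd_iff _).1 hp
    exact A.not_form_dvd_form (Finset.ne_of_mem_erase hG).symm hGd

theorem jacobianIdeal_le_flatIdeal {X : Submodule K (Fin l → K)} (hX : X ∈ A.flatsOfRank 2) :
    A.jacobianIdeal ≤ A.flatIdeal X := by
  classical
  obtain ⟨H, G, hHG, rfl⟩ := A.exists_eq_inf_of_mem_flatsOfRank_two hX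
  rw [A.flatIdeal_inf_pair]
  have hH : A.form H ∈ Ideal.span {A.form H, A.form G} := Ideal.subset_span (.inl rfl)
  have hG : A.form G ∈ Ideal.span {A.form H, A.form G} := Ideal.subset_span (.inr rfl)
  have hR : ∏ F ∈ Finset.univ.erase H, A.form F ∈ Ideal.span {A.form H, A.form G} :=
    Ideal.mem_of_dvd _ (Finset.dvd_prod_of_mem _
      (Finset.mem_erase.2 ⟨hHG.symm, Finset.mem_univ G⟩)) hG
  intro f hf
  obtain ⟨δ, h, rfl⟩ := A.mem_jacobianIdeal_iff.1 hf
  rw [A.definingPolynomial_eq_mul H, Derivation.leibniz, smul_eq_mul, smul_eq_mul]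
  exact add_mem (add_mem (Ideal.mul_mem_right _ _ hH) (Ideal.mul_mem_right _ _ hR))
    (Ideal.mul_mem_left _ _ (Ideal.mul_mem_right _ _ hH))

/-- A prime ideal containing the Jacobian ideal contains two of the linear forms. -/
theorem exists_forms_mem_of_jacobianIdeal_le {P : Ideal (MvPolynomial (Fin l) K)} [hP : P.IsPrime]
    (h : A.jacobianIdeal ≤ P) :
    ∃ H G : {H // H ∈ A.hyperplanes}, H ≠ G ∧ A.form H ∈ P ∧ A.form G ∈ P := by
  classical
  have hQ : A.definingPolynomial ∈ P := h (Ideal.subset_span (.inl rfl))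
  obtain ⟨H, -, hH⟩ := Ideal.IsPrime.prod_mem_iff.1 hQ
  obtain ⟨c, hc⟩ := A.exists_form_eq_sum H
  obtain ⟨j, hj⟩ : ∃ j, c j ≠ 0 := by
    by_contra! hall
    refine (A.form_prime H).ne_zero ?_
    rw [← hc]
    simp [hall]
  have hd : pderiv j (A.form H) = C (c j) := by
    rw [← hc]
    simp [pderiv_X, Pi.single_apply, smul_eq_C_mul]
  -- Modulo `α_H`, this derivative is the product of the other forms times the nonzero constant `c
  -- j`.
  have hQj : pderiv j A.definingPolynomial ∈ P := h (Ideal.subset_span (.inr ⟨j, rfl⟩))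
  rw [A.definingPolynomial_eq_mul H, Derivation.leibniz, smul_eq_mul, smul_eq_mul,
    Ideal.add_mem_iff_right _ (Ideal.mul_mem_right _ _ hH), hd] at hQj
  have hcP : C (c j) ∉ P := fun hm =>
    hP.ne_top (P.eq_top_of_isUnit_mem hm ((isUnit_iff_ne_zero.2 hj).map C))
  obtain ⟨G, hG, hGP⟩ := Ideal.IsPrime.prod_mem_iff.1 ((hP.mem_or_mem hQj).resolve_right hcP)
  exact ⟨H, G, (Finset.ne_of_mem_erase hG).symm, hH, hGP⟩

theorem flatIdeal_isPrime {X : Submodule K (Fin l → K)} (hX : X ∈ A.flatsOfRank 2) :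
    (A.flatIdeal X).IsPrime := by
  obtain ⟨H, G, hHG, rfl⟩ := A.exists_eq_inf_of_mem_flatsOfRank_two hX
  rw [A.flatIdeal_inf_pair]
  exact A.span_pair_form_isPrime hHG

/-- A prime between `J` and `I(X)` contains two forms; these vanish on `X`, so by codimension they
already cut out `X` and generate `I(X)`. -/
theorem flatIdeal_mem_minimalPrimes {X : Submodule K (Fin l → K)} (hX : X ∈ A.flatsOfRank 2) :
    A.flatIdeal X ∈ A.jacobianIdeal.minimalPrimes := by
  refine ⟨⟨A.flatIdeal_isPrime hX, A.jacobianIdeal_le_flatIdeal hX⟩, fun P ⟨hP, hJP⟩ hPX => ?_⟩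
  obtain ⟨H, G, hHG, hH, hG⟩ := A.exists_forms_mem_of_jacobianIdeal_le hJP
  have hle : X ≤ H.1 ⊓ G.1 := fun v hv =>
    ⟨(A.form_zero_locus H v).1 (A.eval_eq_zero_of_mem_flatIdeal (hPX hH) hv),
      (A.form_zero_locus G v).1 (A.eval_eq_zero_of_mem_flatIdeal (hPX hG) hv)⟩
  rw [eq_of_le_of_finrank_quotient_eq hle (hX.2.trans (A.finrank_quotient_inf hHG).symm),
    A.flatIdeal_inf_pair, Ideal.span_le]
  rintro _ (rfl | rfl)
  exacts [hH, hG]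

/-! ### Freeness and associated primes -/

/-- If `D(A)` is free, then no regular sequence `a, b, g` multiplies an element outside the
Jacobian ideal into it. -/
theorem mem_jacobianIdeal_of_regular {ι : Type*} [Fintype ι]
    (β : Module.Basis ι (MvPolynomial (Fin l) K) A.logDerivations)
    {a b g f : MvPolynomial (Fin l) K} (ha : a ≠ 0) (hb : ∀ x, a ∣ b * x → a ∣ x)
    (hg : ∀ x, g * x ∈ Ideal.span {a, b} → x ∈ Ideal.span {a, b})
    (haf : a * f ∈ A.jacobianIdeal) (hbf : b * f ∈ A.jacobianIdeal)
    (hgf : g * f ∈ A.jacobianIdeal) : f ∈ A.jacobianIdeal := by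
  have hQ0 : A.definingPolynomial ≠ 0 :=
    Finset.prod_ne_zero_iff.2 fun H _ => (A.form_prime H).ne_zero
  obtain ⟨δa, ha', ea⟩ := A.mem_jacobianIdeal_iff.1 haf
  obtain ⟨δb, hb', eb⟩ := A.mem_jacobianIdeal_iff.1 hbf
  obtain ⟨δg, hg', eg⟩ := A.mem_jacobianIdeal_iff.1 hgf
  set Q := A.definingPolynomial with hQ
  have syz : ∀ {x y h k : MvPolynomial (Fin l) K}
      {δ η : Derivation K (MvPolynomial (Fin l) K) (MvPolynomial (Fin l) K)},
      x * f = δ Q + h * Q → y * f = η Q + k * Q →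
      (y • δ - x • η) Q = Q * (x * k - y * h) := fun {x y h k δ η} h1 h2 => by
    simp only [Derivation.sub_apply, Derivation.smul_apply, smul_eq_mul]
    linear_combination x * h2 - y * h1
  have mem : ∀ {x y h k : MvPolynomial (Fin l) K}
      {δ η : Derivation K (MvPolynomial (Fin l) K) (MvPolynomial (Fin l) K)},
      x * f = δ Q + h * Q → y * f = η Q + k * Q → y • δ - x • η ∈ A.logDerivations :=
    fun h1 h2 => A.mem_logDerivations_iff.2 ⟨_, syz h1 h2⟩
  let wab : A.logDerivations := ⟨_, mem ea eb⟩
  let wag : A.logDerivations := ⟨_, mem ea eg⟩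
  let wbg : A.logDerivations := ⟨_, mem eb eg⟩
  -- The Koszul relation among the three syzygies; in coordinates of the basis it puts `g` times
  -- each coordinate of `wab` in `(a, b)`.
  have hrel : g • wab + a • wbg = b • wag := Subtype.ext <| by
    change g • (b • δa - a • δb) + a • (g • δb - b • δg) = b • (g • δa - a • δg)
    simp only [smul_sub, smul_smul, mul_comm]
    abel
  have hcoord : ∀ i, ∃ p q, p * a + q * b = β.repr wab i := fun i => by
    refine Ideal.mem_span_pair.1 (hg _ (Ideal.mem_span_pair.2
      ⟨-β.repr wbg i, β.repr wag i, ?_⟩))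
    have := DFunLike.congr_fun (congrArg β.repr hrel) i
    simp only [map_add, map_smul, Finsupp.add_apply, Finsupp.smul_apply, smul_eq_mul] at this
    linear_combination -this
  choose q p hpq using hcoord
  let u : A.logDerivations := ∑ i, p i • β i
  let v : A.logDerivations := ∑ i, q i • β i
  have hw : wab = b • u + a • v := by
    rw [← β.sum_repr wab]
    simp only [u, v, Finset.smul_sum, ← Finset.sum_add_distrib, smul_smul, ← add_smul]
    exact Finset.sum_congr rfl fun i _ => by rw [← hpq, mul_comm b, mul_comm a, add_comm]
  have hw' : b • δa - a • δb = b • u.1 + a • v.1 := congrArg Subtype.val hw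
  obtain ⟨u', hu'⟩ := A.mem_logDerivations_iff.1 u.2
  obtain ⟨v', hv'⟩ := A.mem_logDerivations_iff.1 v.2
  rw [← hQ] at hu' hv'
  -- Correcting by `u` and `v` turns `wab = b • u + a • v` into `b • (δa - u) = a • (δb + v)`, so
  -- `δa - u` is divisible by `a`.
  obtain ⟨η, hη, -⟩ := dvd_derivation_of_mul_eq_mul ha hb (δa - u.1) (δb + v.1) <| by
    rw [smul_sub, smul_add, sub_eq_iff_eq_add, add_assoc, add_comm (a • v.1), ← hw']
    abel
  have hcof : a * hb' - b * ha' = b * u' + a * v' := by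
    apply mul_left_cancel₀ hQ0
    rw [← syz ea eb, hw']
    simp only [Derivation.add_apply, Derivation.smul_apply, smul_eq_mul, hu', hv']
    ring
  -- The cofactors of `Q` satisfy the same kind of relation, so `a * f = a * (η Q + k * Q)`, and `a`
  -- cancels.
  obtain ⟨k, hk⟩ := hb (ha' + u') ⟨hb' - v', by linear_combination -hcof⟩
  refine A.mem_jacobianIdeal_iff.2 ⟨η, k, mul_left_cancel₀ ha ?_⟩
  have hηQ : δa Q - u.1 Q = a * η Q := by
    simpa using congrArg (fun d => d Q) hη
  rw [← hQ]
  linear_combination ea + hηQ + hu' + Q * hk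

theorem eq_flatIdeal_of_mem_associatedPrimes {ι : Type*} [Fintype ι]
    (β : Module.Basis ι (MvPolynomial (Fin l) K) A.logDerivations)
    {P : Ideal (MvPolynomial (Fin l) K)}
    (hP : P ∈ associatedPrimes (MvPolynomial (Fin l) K)
      (MvPolynomial (Fin l) K ⧸ A.jacobianIdeal)) :
    ∃ X ∈ A.flatsOfRank 2, P = A.flatIdeal X := by
  obtain ⟨hPprime, x, hx⟩ := isAssociatedPrime_iff.1 hP
  obtain ⟨f, rfl⟩ := Ideal.Quotient.mk_surjective x
  have hmem : ∀ r, r ∈ P ↔ r * f ∈ A.jacobianIdeal := fun r => by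
    rw [hx, Submodule.mem_colon_singleton, Submodule.mem_bot]
    exact Ideal.Quotient.eq_zero_iff_mem (a := r * f)
  obtain ⟨H, G, hHG, hH, hG⟩ := A.exists_forms_mem_of_jacobianIdeal_le
    (P := P) fun r hr => (hmem r).2 (Ideal.mul_mem_right _ _ hr)
  refine ⟨_, A.inf_mem_flatsOfRank_two hHG, ?_⟩
  rw [A.flatIdeal_inf_pair]
  have hle : Ideal.span {A.form H, A.form G} ≤ P := Ideal.span_le.2 <| by
    rintro _ (rfl | rfl)
    exacts [hH, hG]
  refine le_antisymm (fun g hg => ?_) hle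
  -- Such a `g` is regular modulo the prime `(α_H, α_G)`, which puts `f` in `J` and makes `P` the
  -- unit ideal.
  by_contra hgn
  have hf : f ∈ A.jacobianIdeal := A.mem_jacobianIdeal_of_regular β (A.form_prime H).ne_zero
    (fun x hx => ((A.form_prime H).dvd_or_dvd hx).resolve_left (A.not_form_dvd_form hHG))
    (fun x hx => ((A.span_pair_form_isPrime hHG).mem_or_mem hx).resolve_left hgn)
    ((hmem _).1 hH) ((hmem _).1 hG) ((hmem _).1 hg)
  exact hPprime.ne_top (P.eq_top_iff_one.2 ((hmem 1).2 (by rwa [one_mul])))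

end CentralArrangement

theorem corollary4p5 {K : Type*} [Field K] [CharZero K] {l : ℕ} (A : CentralArrangement K l)
    (hA : A.IsFree) :
    associatedPrimes (MvPolynomial (Fin l) K) (MvPolynomial (Fin l) K ⧸ A.jacobianIdeal) =
        {P | ∃ X ∈ A.flatsOfRank 2, P = A.flatIdeal X} ∧
      ∀ P ∈ associatedPrimes (MvPolynomial (Fin l) K)
          (MvPolynomial (Fin l) K ⧸ A.jacobianIdeal),
        P ∈ A.jacobianIdeal.minimalPrimes := by
  obtain ⟨e, β, -⟩ := hA
  have hsub : ∀ P ∈ associatedPrimes (MvPolynomial (Fin l) K)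
      (MvPolynomial (Fin l) K ⧸ A.jacobianIdeal), ∃ X ∈ A.flatsOfRank 2, P = A.flatIdeal X :=
    fun P hP => A.eq_flatIdeal_of_mem_associatedPrimes β hP
  refine ⟨Set.Subset.antisymm hsub ?_, fun P hP => ?_⟩
  · rintro _ ⟨X, hX, rfl⟩
    apply Module.associatedPrimes.minimalPrimes_annihilator_subset_associatedPrimes
    rw [Ideal.annihilator_quotient]
    exact A.flatIdeal_mem_minimalPrimes hX
  · obtain ⟨X, hX, rfl⟩ := hsub P hP
    exact A.flatIdeal_mem_minimalPrimes hX
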